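/- Let $q,\tilde q\in L^1([0,\pi];\mathbb C)$, let $r\in[0,\pi)$, $x_0\in(r,\pi]$, $m\in\mathbb N_0=\{0,1,2,\dots\}$ and $\zeta>0$. For $i=1,2$ and $\lambda\in\mathbb C$ let $y_{i,r}(\cdot,\lambda)$ and $\tilde y_{i,r}(\cdot,\lambda)$ be the solutions on $[0,\pi]$ (continuously differentiable with absolutely continuous derivative, the equation holding almost everywhere) of $$-y''+q(x)y=\lambda y\qquad\text{and}\qquad -y''+\tilde q(x)y=\lambda y,$$ respectively, with the initial conditions $$y_{1,r}(r,\lambda)=\tilde y_{1,r}(r,\lambda)=1,\quad y_{1,r}'(r,\lambda)=\tilde y_{1,r}'(r,\lambda)=0,\quad y_{2,r}(r,\lambda)=\tilde y_{2,r}(r,\lambda)=0,\quad y_{2,r}'(r,\lambda)=\tilde y_{2,r}'(r,\lambda)=1,$$ where $'$ denotes $d/dx$ (one-sided at the endpoints of $[0,\pi]$). Assume that $q,\tilde q\in C^m[x_0-\delta,x_0]$ for some $\delta>0$ and that their left derivatives at $x_0$ satisfy $q_-^{(j)}(x_0)=\tilde q_-^{(j)}(x_0)$ for $j=0,1,\dots,m$.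 Then, as $|\lambda|\to\infty$ in the sector $\Lambda_\zeta=\{\lambda\in\mathbb C:\zeta<\operatorname{Arg}\lambda<\pi-\zeta\}$, $$y_{1,r}(x_0,\lambda)\tilde y_{1,r}'(x_0,\lambda)-y_{1,r}'(x_0,\lambda)\tilde y_{1,r}(x_0,\lambda)=o\!\left(\frac{e^{2|\operatorname{Im}\sqrt\lambda|(x_0-r)}}{|\sqrt\lambda|^{m+1}}\right),$$ $$y_{1,r}(x_0,\lambda)\tilde y_{2,r}'(x_0,\lambda)-y_{1,r}'(x_0,\lambda)\tilde y_{2,r}(x_0,\lambda)=o\!\left(\frac{e^{2|\operatorname{Im}\sqrt\lambda|(x_0-r)}}{|\sqrt\lambda|^{m+2}}\right),$$ $$\tilde y_{1,r}'(x_0,\lambda)y_{2,r}(x_0,\lambda)-\tilde y_{1,r}(x_0,\lambda)y_{2,r}'(x_0,\lambda)=o\!\left(\frac{e^{2|\operatorname{Im}\sqrt\lambda|(x_0-r)}}{|\sqrt\lambda|^{m+2}}\right),$$ $$y_{2,r}(x_0,\lambda)\tilde y_{2,r}'(x_0,\lambda)-y_{2,r}'(x_0,\lambda)\tilde y_{2,r}(x_0,\lambda)=o\!\left(\frac{e^{2|\operatorname{Im}\sqrt\lambda|(x_0-r)}}{|\sqrt\lambda|^{m+3}}\right).$$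 -/

import Mathlib

open Set Filter MeasureTheory Asymptotics

noncomputable section

namespace SturmLiouville

/-- The derivative of a function on the interval `[0, π]`, one-sided at the two endpoints. -/
def slDeriv (y : ℝ → ℂ) (x : ℝ) : ℂ := derivWithin y (Icc 0 Real.pi) x

/-- `y` is a solution of `-y'' + q y = lam y` on `[0, π]` in the usual sense for an integrable
potential `q`: `y` is differentiable, `y'` is absolutely continuous, and the equation holds
at almost every point. -/
structure IsSolution (q : ℝ → ℂ) (lam : ℂ) (y : ℝ → ℂ) : Prop where
  differentiableOn : DifferentiableOn ℝ y (Icc 0 Real.pi)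
  absolutelyContinuous_deriv : AbsolutelyContinuousOnInterval (slDeriv y) 0 Real.pi
  equation : ∀ᵐ x ∂(volume.restrict (Ioo 0 Real.pi)),
    ∃ y'' : ℂ, HasDerivAt (slDeriv y) y'' x ∧ -y'' + q x * y x = lam * y x

/-- `y x lam = y_{1,r}(x, lam)`: for every `lam`, the solution with `y(r) = 1`, `y'(r) = 0`. -/
def IsFirstFundamental (q : ℝ → ℂ) (r : ℝ) (y : ℝ → ℂ → ℂ) : Prop :=
  ∀ lam : ℂ, IsSolution q lam (fun x => y x lam) ∧
    y r lam = 1 ∧ slDeriv (fun x => y x lam) r = 0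

/-- `y x lam = y_{2,r}(x, lam)`: for every `lam`, the solution with `y(r) = 0`, `y'(r) = 1`. -/
def IsSecondFundamental (q : ℝ → ℂ) (r : ℝ) (y : ℝ → ℂ → ℂ) : Prop :=
  ∀ lam : ℂ, IsSolution q lam (fun x => y x lam) ∧
    y r lam = 0 ∧ slDeriv (fun x => y x lam) r = 1

/-- The Wronskian `⟨y, z⟩ = y z' - y' z` at the point `x`, as a function of `lam`. -/
def wronskian (y z : ℝ → ℂ → ℂ) (x : ℝ) (lam : ℂ) : ℂ :=
  y x lam * slDeriv (fun t => z t lam) x - slDeriv (fun t => y t lam) x * z x lam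

/-- The open sector `ζ < arg lam < π - ζ`. -/
def sector (ζ : ℝ) : Set ℂ := {lam : ℂ | ζ < lam.arg ∧ lam.arg < Real.pi - ζ}

/-- The filter describing `|lam| → ∞` in the sector. -/
def sectorAtInfinity (ζ : ℝ) : Filter ℂ := comap (fun lam : ℂ => ‖lam‖) atTop ⊓ 𝓟 (sector ζ)

/-- The comparison function `exp (2 |Im √lam| (x₀ - r)) / |√lam| ^ n`. -/
def rate (r x₀ : ℝ) (n : ℕ) (lam : ℂ) : ℝ :=
  Real.exp (2 * |(Complex.sqrt lam).im| * (x₀ - r)) / ‖Complex.sqrt lam‖ ^ n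

end SturmLiouville

end

/-!
For solutions `y` of `-y'' + q y = lam y` and `z` of `-z'' + qt z = lam z`, the Wronskian
satisfies `(y z' - y' z)' = (qt - q) y z`, so
`W(x₀) = W(r) + ∫ x in r..x₀, (qt x - q x) * y x * z x` (`IsSolution.wronskian_sub`).
Upper bounds alone are enough to estimate the right-hand side; no asymptotic expansion of the
solutions is needed. Write `k = √lam` and `τ = |Im k|`.

* By Duhamel's formula (`IsSolution.duhamel`), a solution on `[r, x₀]` is at most
  `2 (|y(r)| + |y'(r)| / |k|) exp (τ (x - r))` once `|k|` exceeds twice the `L¹` norm of the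
  potential (`IsSolution.norm_le`). The two fundamental solutions are therefore bounded by
  `2 exp (τ (x - r))` and `2 exp (τ (x - r)) / |k|`.
* By Taylor's formula, agreement of the left derivatives up to order `m` gives
  `qt x - q x = o((x₀ - x) ^ m)` as `x` tends to `x₀` from the left. Hence the integral of
  `|qt x - q x| exp (-2 τ (x₀ - x))` is `o(τ ^ (-(m + 1)))`, an estimate of Watson type
  (`tendsto_pow_mul_integral_mul_exp`).
* In the sector, `τ` is at least a positive multiple of `|k|`
  (`exists_mul_norm_sqrt_le_abs_im`). So powers of `τ` can be traded for powers of `|k|`, and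
  `W(r)`, which is `0` or `±1`, is negligible against `exp (2 τ (x₀ - r)) / |k| ^ n`.

The four cases are instances of `wronskian_isLittleO`, with exponents `a` and `b` recording
the powers of `1 / |k|` gained from the second fundamental solutions.
-/

namespace SturmLiouville

open Topology

/-! ### The fundamental theorem of calculus for complex absolutely continuous functions -/

theorem _root_.AbsolutelyContinuousOnInterval.clm_comp {f : ℝ → ℂ} {a b : ℝ}
    (hf : AbsolutelyContinuousOnInterval f a b) (L : ℂ →L[ℝ] ℝ) :
    AbsolutelyContinuousOnInterval (fun x => L (f x)) a b := by
  unfold AbsolutelyContinuousOnInterval at hf ⊢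
  have h := Tendsto.const_mul ‖L‖ hf
  rw [mul_zero] at h
  refine squeeze_zero (fun E => Finset.sum_nonneg fun i _ => dist_nonneg) (fun E => ?_) h
  rw [Finset.mul_sum]
  exact Finset.sum_le_sum fun i _ => L.lipschitz.dist_le_mul _ _

/-- Mathlib states this fundamental theorem for real-valued functions; the complex version follows
by taking real and imaginary parts. -/
theorem integral_eq_sub_of_ae_hasDerivAt {f g : ℝ → ℂ} {a b : ℝ} (hab : a ≤ b)
    (hf : AbsolutelyContinuousOnInterval f a b) (hg : IntervalIntegrable g volume a b)
    (h : ∀ᵐ x, x ∈ Ioo a b → HasDerivAt f (g x) x) :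
    ∫ x in a..b, g x = f b - f a := by
  have key : ∀ L : ℂ →L[ℝ] ℝ, L (∫ x in a..b, g x) = L (f b - f a) := by
    intro L
    rw [map_sub, ← (hf.clm_comp L).integral_deriv_eq_sub, ← L.intervalIntegral_comp_comm hg]
    refine intervalIntegral.integral_congr_ae ?_
    filter_upwards [h, Measure.ae_ne volume b] with x hx hxb hxI
    rw [uIoc_of_le hab] at hxI
    exact (L.hasFDerivAt.comp_hasDerivAt x
      (hx ⟨hxI.1, lt_of_le_of_ne hxI.2 hxb⟩)).deriv.symm
  exact Complex.ext (key Complex.reCLM) (key Complex.imCLM)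

/-! ### Wronskian identity and Duhamel's formula -/

namespace IsSolution

variable {q : ℝ → ℂ} {lam : ℂ} {y : ℝ → ℂ}

theorem continuousOn_slDeriv (hy : IsSolution q lam y) :
    ContinuousOn (slDeriv y) (Icc 0 Real.pi) := by
  simpa [uIcc_of_le Real.pi_pos.le] using hy.absolutelyContinuous_deriv.continuousOn

theorem absolutelyContinuous (hy : IsSolution q lam y) :
    AbsolutelyContinuousOnInterval y 0 Real.pi := by
  apply ContDiffOn.absolutelyContinuousOnInterval
  rw [uIcc_of_le Real.pi_pos.le,
    show (1 : WithTop ℕ∞) = 0 + 1 by norm_num,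
    contDiffOn_succ_iff_derivWithin (uniqueDiffOn_Icc Real.pi_pos)]
  exact ⟨hy.differentiableOn, by simp, contDiffOn_zero.2 hy.continuousOn_slDeriv⟩

theorem hasDerivAt (hy : IsSolution q lam y) {x : ℝ} (hx : x ∈ Ioo 0 Real.pi) :
    HasDerivAt y (slDeriv y x) x :=
  (hy.differentiableOn x (Ioo_subset_Icc_self hx)).hasDerivWithinAt.hasDerivAt
    (Icc_mem_nhds hx.1 hx.2)

theorem ae_hasDerivAt_slDeriv (hy : IsSolution q lam y) :
    ∀ᵐ x, x ∈ Ioo 0 Real.pi → HasDerivAt (slDeriv y) ((q x - lam) * y x) x := by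
  have h := hy.equation
  rw [ae_restrict_iff' measurableSet_Ioo] at h
  filter_upwards [h] with x hx hxI
  obtain ⟨y'', h1, h2⟩ := hx hxI
  convert h1 using 1
  linear_combination h2

/-- The Wronskian of solutions for two potentials has derivative `(qt - q) y z`. -/
theorem wronskian_sub {qt : ℝ → ℂ} {z : ℝ → ℂ} {a b : ℝ}
    (hq : IntegrableOn q (Icc 0 Real.pi)) (hqt : IntegrableOn qt (Icc 0 Real.pi))
    (hy : IsSolution q lam y) (hz : IsSolution qt lam z)
    (ha : 0 ≤ a) (hab : a ≤ b) (hb : b ≤ Real.pi) :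
    (y b * slDeriv z b - slDeriv y b * z b) - (y a * slDeriv z a - slDeriv y a * z a) =
      ∫ x in a..b, (qt x - q x) * (y x * z x) := by
  have hsub : uIcc a b ⊆ uIcc 0 Real.pi := by
    rw [uIcc_of_le hab, uIcc_of_le Real.pi_pos.le]; exact Icc_subset_Icc ha hb
  have hsub' : uIcc a b ⊆ Icc 0 Real.pi := by rwa [uIcc_of_le Real.pi_pos.le] at hsub
  have hI : IntervalIntegrable (fun x => qt x - q x) volume a b :=
    ((hqt.mono_set hsub').intervalIntegrable).sub (hq.mono_set hsub').intervalIntegrable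
  have hyA := hy.absolutelyContinuous.mono hsub
  have hzA := hz.absolutelyContinuous.mono hsub
  symm
  refine integral_eq_sub_of_ae_hasDerivAt
    (f := fun x => y x * slDeriv z x - slDeriv y x * z x) hab ?_ ?_ ?_
  · exact (hyA.fun_smul (hz.absolutelyContinuous_deriv.mono hsub)).fun_sub
      ((hy.absolutelyContinuous_deriv.mono hsub).fun_smul hzA)
  · exact hI.mul_continuousOn (hyA.continuousOn.mul hzA.continuousOn)
  · filter_upwards [hy.ae_hasDerivAt_slDeriv, hz.ae_hasDerivAt_slDeriv] with x h1 h2 hx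
    have hx' : x ∈ Ioo 0 Real.pi := Ioo_subset_Ioo ha hb hx
    refine (((hy.hasDerivAt hx').mul (h2 hx')).sub
      ((h1 hx').mul (hz.hasDerivAt hx'))).congr_deriv ?_
    ring

/-- Duhamel's formula (variation of constants), treating `q y` as a perturbation of
`-y'' = k ^ 2 y`. It is the fundamental theorem of calculus for
`t ↦ y t * cos (k (b - t)) + y' t * sin (k (b - t)) / k`, whose derivative is
`q t * y t * sin (k (b - t)) / k`. -/
theorem duhamel {k : ℂ} (hk : k ≠ 0) {a b : ℝ}
    (hq : IntegrableOn q (Icc 0 Real.pi)) (hy : IsSolution q (k ^ 2) y)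
    (ha : 0 ≤ a) (hab : a ≤ b) (hb : b ≤ Real.pi) :
    y b = y a * Complex.cos (k * (b - a)) + slDeriv y a * (Complex.sin (k * (b - a)) / k) +
      ∫ t in a..b, q t * (y t * (Complex.sin (k * (b - t)) / k)) := by
  have hsub : uIcc a b ⊆ uIcc 0 Real.pi := by
    rw [uIcc_of_le hab, uIcc_of_le Real.pi_pos.le]; exact Icc_subset_Icc ha hb
  have hsub' : uIcc a b ⊆ Icc 0 Real.pi := by rwa [uIcc_of_le Real.pi_pos.le] at hsub
  have hI : IntervalIntegrable q volume a b := (hq.mono_set hsub').intervalIntegrable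
  have hyA := hy.absolutelyContinuous.mono hsub
  have hc : ContDiff ℝ 1 (fun t : ℝ => Complex.cos (k * (b - t))) :=
    Complex.contDiff_cos.restrict_scalars ℝ |>.comp
      (contDiff_const.mul (contDiff_const.sub Complex.ofRealCLM.contDiff))
  have hs : ContDiff ℝ 1 (fun t : ℝ => Complex.sin (k * (b - t)) / k) :=
    (Complex.contDiff_sin.restrict_scalars ℝ |>.comp
      (contDiff_const.mul (contDiff_const.sub Complex.ofRealCLM.contDiff))).div_const k
  have key := integral_eq_sub_of_ae_hasDerivAt
    (f := fun t : ℝ => y t * Complex.cos (k * (b - t)) +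
      slDeriv y t * (Complex.sin (k * (b - t)) / k))
    (g := fun t => q t * (y t * (Complex.sin (k * (b - t)) / k))) hab
    ((hyA.fun_smul hc.contDiffOn.absolutelyContinuousOnInterval).fun_add
      ((hy.absolutelyContinuous_deriv.mono hsub).fun_smul
        hs.contDiffOn.absolutelyContinuousOnInterval))
    (hI.mul_continuousOn (hyA.continuousOn.mul hs.continuous.continuousOn)) (by
      filter_upwards [hy.ae_hasDerivAt_slDeriv] with x h1 hx
      have hx' : x ∈ Ioo 0 Real.pi := Ioo_subset_Ioo ha hb hx
      have hl : HasDerivAt (fun t : ℝ => k * ((b : ℂ) - t)) (-k) x := by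
        simpa using ((Complex.ofRealCLM.hasDerivAt (x := x)).const_sub (b : ℂ)).const_mul k
      have hcos := (Complex.hasDerivAt_cos (k * ((b : ℂ) - x))).comp x hl
      have hsin := ((Complex.hasDerivAt_sin (k * ((b : ℂ) - x))).comp x hl).div_const k
      refine (((hy.hasDerivAt hx').mul hcos).add ((h1 hx').mul hsin)).congr_deriv ?_
      simp only [Function.comp_apply]
      field_simp
      ring)
  simp only [sub_self, mul_zero, Complex.cos_zero, mul_one, Complex.sin_zero, zero_div,
    add_zero] at key
  rw [key]
  ring

end IsSolution

/-! ### Exponential bounds for solutions -/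

theorem norm_exp_mul_le (k : ℂ) {s : ℝ} (hs : 0 ≤ s) {w : ℂ} (hw : w.re = 0) (hw1 : |w.im| = 1) :
    ‖Complex.exp (k * s * w)‖ ≤ Real.exp (|k.im| * s) := by
  rw [Complex.norm_exp]
  gcongr
  have : (k * s * w).re = -(k.im * w.im) * s := by
    simp [Complex.mul_re, hw, Complex.mul_im]; ring
  rw [this]
  gcongr
  calc _ ≤ |-(k.im * w.im)| := le_abs_self _
    _ = _ := by rw [abs_neg, abs_mul, hw1, mul_one]

theorem norm_cos_mul_le (k : ℂ) {s : ℝ} (hs : 0 ≤ s) :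
    ‖Complex.cos (k * s)‖ ≤ Real.exp (|k.im| * s) := by
  have h1 := norm_exp_mul_le k hs (w := Complex.I) (by simp) (by simp)
  have h2 := norm_exp_mul_le k hs (w := -Complex.I) (by simp) (by simp)
  rw [mul_neg, ← neg_mul] at h2
  rw [Complex.cos, norm_div, Complex.norm_ofNat, div_le_iff₀ two_pos]
  linarith [norm_add_le (Complex.exp (k * s * Complex.I)) (Complex.exp (-(k * s) * Complex.I))]

theorem norm_sin_mul_le (k : ℂ) {s : ℝ} (hs : 0 ≤ s) :
    ‖Complex.sin (k * s)‖ ≤ Real.exp (|k.im| * s) := by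
  have h1 := norm_exp_mul_le k hs (w := Complex.I) (by simp) (by simp)
  have h2 := norm_exp_mul_le k hs (w := -Complex.I) (by simp) (by simp)
  rw [mul_neg, ← neg_mul] at h2
  rw [Complex.sin, norm_div, Complex.norm_ofNat, div_le_iff₀ two_pos, norm_mul, Complex.norm_I,
    mul_one]
  linarith [norm_sub_le (Complex.exp (-(k * s) * Complex.I)) (Complex.exp (k * s * Complex.I))]

/-- In Duhamel's formula, evaluated where `‖y t‖ * exp (-τ (t - r))` attains its maximum `M`, the
lower bound on `‖k‖` makes the integral term at most `M / 2`, which is absorbed on the left. -/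
theorem IsSolution.norm_le {q : ℝ → ℂ} {y : ℝ → ℂ} {k : ℂ} {r x : ℝ}
    (hq : IntegrableOn q (Icc 0 Real.pi)) (hy : IsSolution q (k ^ 2) y) (hk : k ≠ 0)
    (hkq : 2 * ∫ t in Icc 0 Real.pi, ‖q t‖ ≤ ‖k‖)
    (hr : 0 ≤ r) (hrx : r ≤ x) (hx : x ≤ Real.pi) :
    ‖y x‖ ≤ 2 * (‖y r‖ + ‖slDeriv y r‖ / ‖k‖) * Real.exp (|k.im| * (x - r)) := by
  set τ := |k.im|
  set A := ‖y r‖ + ‖slDeriv y r‖ / ‖k‖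
  have hk0 : 0 < ‖k‖ := norm_pos_iff.2 hk
  have hsubr : Icc r Real.pi ⊆ Icc 0 Real.pi := Icc_subset_Icc_left hr
  have hyc : ContinuousOn y (Icc r Real.pi) := hy.differentiableOn.continuousOn.mono hsubr
  obtain ⟨b, hbI, hb⟩ := isCompact_Icc.exists_isMaxOn (nonempty_Icc.2 (hrx.trans hx))
    (f := fun t => ‖y t‖ * Real.exp (-(τ * (t - r)))) (by fun_prop)
  set M := ‖y b‖ * Real.exp (-(τ * (b - r)))
  have hM : ∀ t ∈ Icc r Real.pi, ‖y t‖ ≤ M * Real.exp (τ * (t - r)) := by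
    intro t ht
    have h : ‖y t‖ * Real.exp (-(τ * (t - r))) ≤ M := hb ht
    calc ‖y t‖ = ‖y t‖ * Real.exp (-(τ * (t - r))) * Real.exp (τ * (t - r)) := by
          rw [mul_assoc, ← Real.exp_add]; simp
      _ ≤ _ := by gcongr
  have hM0 : 0 ≤ M := by positivity
  have hd := hy.duhamel hk hq hr hbI.1 hbI.2
  have hsb : 0 ≤ b - r := sub_nonneg.2 hbI.1
  have hqI : IntegrableOn (fun t => ‖q t‖) (Icc 0 Real.pi) := hq.norm
  have hqb : IntervalIntegrable (fun t => ‖q t‖) volume r b :=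
    (hqI.mono_set (by rw [uIcc_of_le hbI.1]; exact Icc_subset_Icc hr hbI.2)).intervalIntegrable
  have hint : ‖∫ t in r..b, q t * (y t * (Complex.sin (k * (b - t)) / k))‖ ≤
      M / 2 * Real.exp (τ * (b - r)) := by
    calc _ ≤ ∫ t in r..b, ‖q t‖ * (M * Real.exp (τ * (b - r)) / ‖k‖) := by
          refine intervalIntegral.norm_integral_le_of_norm_le hbI.1 ?_ (hqb.mul_const _)
          refine Eventually.of_forall fun t ht => ?_
          rw [norm_mul, norm_mul, norm_div]
          have h1 := hM t ⟨ht.1.le, ht.2.trans hbI.2⟩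
          have h2 := norm_sin_mul_le k (sub_nonneg.2 ht.2)
          rw [Complex.ofReal_sub] at h2
          rw [← mul_div_assoc]
          have h3 : ‖y t‖ * ‖Complex.sin (k * (b - t))‖ ≤ M * Real.exp (τ * (b - r)) := by
            calc ‖y t‖ * ‖Complex.sin (k * (b - t))‖
                ≤ (M * Real.exp (τ * (t - r))) * Real.exp (τ * (b - t)) := by gcongr
              _ = _ := by rw [mul_assoc, ← Real.exp_add]; ring_nf
          gcongr
      _ = (∫ t in r..b, ‖q t‖) * (M * Real.exp (τ * (b - r)) / ‖k‖) := by
          rw [intervalIntegral.integral_mul_const]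
      _ ≤ (‖k‖ / 2) * (M * Real.exp (τ * (b - r)) / ‖k‖) := by
          gcongr
          rw [intervalIntegral.integral_of_le hbI.1]
          have : ∫ t in Ioc r b, ‖q t‖ ≤ ∫ t in Icc 0 Real.pi, ‖q t‖ :=
            setIntegral_mono_set hqI (Eventually.of_forall fun _ => norm_nonneg _)
              (Ioc_subset_Icc_self.trans (Icc_subset_Icc hr hbI.2)).eventuallyLE
          linarith
      _ = _ := by field_simp
  have hfree : ‖y r * Complex.cos (k * (b - r)) + slDeriv y r * (Complex.sin (k * (b - r)) / k)‖
      ≤ A * Real.exp (τ * (b - r)) := by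
    have h1 := norm_cos_mul_le k hsb
    have h2 := norm_sin_mul_le k hsb
    rw [Complex.ofReal_sub] at h1 h2
    calc _ ≤ ‖y r‖ * ‖Complex.cos (k * (b - r))‖ +
          ‖slDeriv y r‖ * (‖Complex.sin (k * (b - r))‖ / ‖k‖) := by
          refine (norm_add_le _ _).trans ?_
          simp only [norm_mul, norm_div, le_refl]
      _ ≤ ‖y r‖ * Real.exp (τ * (b - r)) + ‖slDeriv y r‖ * (Real.exp (τ * (b - r)) / ‖k‖) := by
          gcongr
      _ = _ := by simp only [A]; ring
  have hMA : M ≤ 2 * A := by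
    have h1 : ‖y b‖ ≤ (A + M / 2) * Real.exp (τ * (b - r)) := by
      rw [hd]
      refine (norm_add_le _ _).trans ?_
      linarith
    have h2 : M ≤ A + M / 2 := by
      calc M ≤ (A + M / 2) * Real.exp (τ * (b - r)) * Real.exp (-(τ * (b - r))) := by
            simp only [M]; gcongr
        _ = _ := by rw [mul_assoc, ← Real.exp_add]; simp
    linarith
  exact (hM x ⟨hrx, hx⟩).trans (by gcongr)


/-! ### An integral estimate of Watson type -/

theorem sub_isLittleO_pow_of_iteratedDerivWithin_eq {f g : ℝ → ℂ} {x₀ δ : ℝ} {m : ℕ} (hδ : 0 < δ)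
    (hf : ContDiffOn ℝ m f (Icc (x₀ - δ) x₀)) (hg : ContDiffOn ℝ m g (Icc (x₀ - δ) x₀))
    (h : ∀ j : ℕ, j ≤ m → iteratedDerivWithin j f (Icc (x₀ - δ) x₀) x₀ =
      iteratedDerivWithin j g (Icc (x₀ - δ) x₀) x₀) :
    (fun x => f x - g x) =o[𝓝[≤] x₀] fun x => (x - x₀) ^ m := by
  have hx : x₀ ∈ Icc (x₀ - δ) x₀ := ⟨by linarith, le_rfl⟩
  have hT : taylorWithinEval f m (Icc (x₀ - δ) x₀) x₀ =
      taylorWithinEval g m (Icc (x₀ - δ) x₀) x₀ := by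
    ext1 x
    rw [taylor_within_apply, taylor_within_apply]
    refine Finset.sum_congr rfl fun j hj => ?_
    rw [h j (Nat.lt_succ_iff.1 (Finset.mem_range.1 hj))]
  have h1 := taylor_isLittleO (convex_Icc _ _) hx hf
  have h2 := taylor_isLittleO (convex_Icc _ _) hx hg
  rw [nhdsWithin_Icc_eq_nhdsLE (by linarith)] at h1 h2
  simpa [hT] using h1.sub h2

theorem integral_exp_neg_mul_sub_le {τ r x₀ : ℝ} (hτ : 0 < τ) :
    ∫ x in r..x₀, Real.exp (-(τ * (x₀ - x))) ≤ 1 / τ := by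
  have hd : ∀ x ∈ uIcc r x₀, HasDerivAt (fun x => Real.exp (-(τ * (x₀ - x))) / τ)
      (Real.exp (-(τ * (x₀ - x)))) x := by
    intro x _
    refine ((((hasDerivAt_id x).const_sub x₀).const_mul τ).neg.exp.div_const τ).congr_deriv ?_
    simp only [id]
    field_simp
    simp
  rw [intervalIntegral.integral_eq_sub_of_hasDerivAt hd
    (Continuous.intervalIntegrable (by fun_prop) _ _)]
  have : 0 ≤ Real.exp (-(τ * (x₀ - r))) / τ := by positivity
  simp only [sub_self, mul_zero, neg_zero, Real.exp_zero]
  linarith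

theorem tendsto_pow_mul_exp_neg_mul (n : ℕ) {d : ℝ} (hd : 0 < d) :
    Tendsto (fun τ : ℝ => τ ^ n * Real.exp (-(2 * τ * d))) atTop (𝓝 0) := by
  have h := (isLittleO_pow_exp_pos_mul_atTop n (b := 2 * d) (by positivity)).tendsto_div_nhds_zero
  refine h.congr fun τ => ?_
  rw [div_eq_mul_inv, ← Real.exp_neg]
  ring_nf

/-- Watson-type estimate: if `g x = o((x₀ - x) ^ m)` at the endpoint `x₀`, then its integral against
`exp (-2 τ (x₀ - x))` is `o(τ ^ (-(m + 1)))`. Near `x₀`, the bound `s ^ m ≤ m! * exp s` with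
`s = τ (x₀ - x)` uses up half of the exponent and the other half is integrated; away from `x₀` the
exponential is uniformly small. -/
theorem tendsto_pow_mul_integral_mul_exp {g : ℝ → ℝ} {r x₀ : ℝ} {m : ℕ} (hr : r ≤ x₀)
    (hg : IntervalIntegrable g volume r x₀) (h0 : ∀ x, 0 ≤ g x)
    (ho : g =o[𝓝[≤] x₀] fun x => (x - x₀) ^ m) :
    Tendsto (fun τ : ℝ => τ ^ (m + 1) * ∫ x in r..x₀, g x * Real.exp (-(2 * τ * (x₀ - x))))
      atTop (𝓝 0) := by
  rw [Metric.tendsto_nhds]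
  intro ε hε
  set η : ℝ := ε / (2 * m.factorial)
  have hm : (0 : ℝ) < m.factorial := by exact_mod_cast m.factorial_pos
  have hη : 0 < η := by positivity
  obtain ⟨l, hl, hlg⟩ := mem_nhdsLE_iff_exists_Ioc_subset.1 (ho.def hη)
  simp only [mem_Iio] at hl
  have htail := (tendsto_pow_mul_exp_neg_mul (m + 1) (sub_pos.2 hl)).const_mul
    (∫ x in r..x₀, g x)
  rw [mul_zero] at htail
  filter_upwards [eventually_gt_atTop 0, htail.eventually_lt_const (half_pos hε)] with τ hτ hτ2
  have hpt : ∀ x ∈ Icc r x₀, g x * Real.exp (-(2 * τ * (x₀ - x))) ≤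
      η * m.factorial / τ ^ m * Real.exp (-(τ * (x₀ - x))) +
        g x * Real.exp (-(2 * τ * (x₀ - l))) := by
    intro x hx
    have hs : 0 ≤ x₀ - x := sub_nonneg.2 hx.2
    rcases lt_or_ge l x with hlx | hlx
    · have h1 : g x ≤ η * (x₀ - x) ^ m := by
        have : ‖g x‖ ≤ η * ‖(x - x₀) ^ m‖ := hlg ⟨hlx, hx.2⟩
        rwa [Real.norm_of_nonneg (h0 x), norm_pow, norm_sub_rev, Real.norm_of_nonneg hs] at this
      have h2 := Real.pow_div_factorial_le_exp _ (mul_nonneg hτ.le hs) m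
      rw [div_le_iff₀ hm, mul_pow] at h2
      have h3 : (x₀ - x) ^ m ≤ m.factorial / τ ^ m * Real.exp (τ * (x₀ - x)) := by
        rw [div_mul_eq_mul_div, le_div_iff₀ (by positivity)]
        linarith
      have h4 : 0 ≤ g x * Real.exp (-(2 * τ * (x₀ - l))) := mul_nonneg (h0 x) (Real.exp_pos _).le
      calc g x * Real.exp (-(2 * τ * (x₀ - x)))
          ≤ η * (m.factorial / τ ^ m * Real.exp (τ * (x₀ - x))) *
              Real.exp (-(2 * τ * (x₀ - x))) := by
            gcongr
            exact h1.trans (by gcongr)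
        _ = η * m.factorial / τ ^ m * Real.exp (-(τ * (x₀ - x))) := by
            rw [mul_assoc, mul_assoc, ← Real.exp_add]
            ring_nf
        _ ≤ _ := by linarith
    · have h4 : 0 ≤ η * m.factorial / τ ^ m * Real.exp (-(τ * (x₀ - x))) := by positivity
      have h5 : g x * Real.exp (-(2 * τ * (x₀ - x))) ≤ g x * Real.exp (-(2 * τ * (x₀ - l))) := by
        have := h0 x
        gcongr
      linarith
  have hc : ∀ c : ℝ, Continuous fun x => Real.exp (-(c * τ * (x₀ - x))) := by
    intro c; fun_prop
  have hI1 : IntervalIntegrable (fun x => g x * Real.exp (-(2 * τ * (x₀ - x)))) volume r x₀ :=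
    hg.mul_continuousOn (hc 2).continuousOn
  have hI2 : IntervalIntegrable
      (fun x => η * m.factorial / τ ^ m * Real.exp (-(τ * (x₀ - x)))) volume r x₀ :=
    Continuous.intervalIntegrable (by fun_prop) _ _
  have hI3 := hg.mul_const (Real.exp (-(2 * τ * (x₀ - l))))
  have hle := intervalIntegral.integral_mono_on hr hI1 (hI2.add hI3) hpt
  rw [intervalIntegral.integral_add hI2 hI3, intervalIntegral.integral_const_mul,
    intervalIntegral.integral_mul_const] at hle
  have hnn : 0 ≤ ∫ x in r..x₀, g x * Real.exp (-(2 * τ * (x₀ - x))) :=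
    intervalIntegral.integral_nonneg hr fun x _ => mul_nonneg (h0 x) (Real.exp_pos _).le
  rw [dist_zero_right, Real.norm_of_nonneg (by positivity)]
  calc _ ≤ τ ^ (m + 1) * (η * m.factorial / τ ^ m * (1 / τ) +
          (∫ x in r..x₀, g x) * Real.exp (-(2 * τ * (x₀ - l)))) := by
        gcongr
        refine hle.trans ?_
        gcongr
        exact integral_exp_neg_mul_sub_le hτ
    _ = ε / 2 + (∫ x in r..x₀, g x) * (τ ^ (m + 1) * Real.exp (-(2 * τ * (x₀ - l)))) := by
        simp only [η]
        field_simp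
        ring
    _ < ε := by linarith

/-! ### The square root in a sector -/

theorem complexSqrt_sq (lam : ℂ) : Complex.sqrt lam ^ 2 = lam := by
  simp [Complex.sqrt]

theorem norm_complexSqrt (lam : ℂ) : ‖Complex.sqrt lam‖ = √‖lam‖ := by
  rw [← Real.sqrt_sq (norm_nonneg (Complex.sqrt lam)), ← norm_pow, complexSqrt_sq]

theorem exists_mul_norm_sqrt_le_abs_im {ζ : ℝ} (hζ : 0 < ζ) :
    ∃ c > 0, ∀ lam ∈ sector ζ, c * ‖Complex.sqrt lam‖ ≤ |(Complex.sqrt lam).im| := by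
  -- Any `ζ > 0` is allowed (the sector is empty for large `ζ`); the cutoff keeps the angle in
  -- `(0, π)`, where the cosine is decreasing.
  set θ := min ζ 1
  have hθ : 0 < θ := lt_min hζ one_pos
  have hcos : Real.cos θ < 1 := by
    have := Real.cos_lt_cos_of_nonneg_of_le_pi le_rfl
      ((min_le_right ζ 1).trans (by linarith [Real.pi_gt_three])) hθ
    rwa [Real.cos_zero] at this
  refine ⟨√((1 - Real.cos θ) / 2), Real.sqrt_pos.2 (by linarith), fun lam hlam => ?_⟩
  have hre : lam.re ≤ ‖lam‖ * Real.cos θ := by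
    rw [← Complex.norm_mul_cos_arg]
    gcongr
    exact Real.cos_le_cos_of_nonneg_of_le_pi hθ.le (Complex.arg_le_pi _)
      ((min_le_left _ _).trans hlam.1.le)
  rw [norm_complexSqrt, Complex.sqrt, Complex.abs_cpow_inv_two_im, ← Real.sqrt_mul (by linarith)]
  apply Real.sqrt_le_sqrt
  linarith

theorem tendsto_norm_sqrt (ζ : ℝ) :
    Tendsto (fun lam => ‖Complex.sqrt lam‖) (sectorAtInfinity ζ) atTop := by
  simp only [norm_complexSqrt]
  exact Real.tendsto_sqrt_atTop.comp (tendsto_comap.mono_left inf_le_left)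

theorem tendsto_abs_im_sqrt {ζ : ℝ} (hζ : 0 < ζ) :
    Tendsto (fun lam => |(Complex.sqrt lam).im|) (sectorAtInfinity ζ) atTop := by
  obtain ⟨c, hc, h⟩ := exists_mul_norm_sqrt_le_abs_im hζ
  refine tendsto_atTop_mono' _ ?_ ((tendsto_norm_sqrt ζ).const_mul_atTop hc)
  exact mem_inf_of_right h

/-! ### Asymptotics of the Wronskian -/

theorem eventually_norm_solution_le {q : ℝ → ℂ} (hq : IntegrableOn q (Icc 0 Real.pi))
    {r x₀ : ℝ} (hr : 0 ≤ r) (hx₀ : x₀ ≤ Real.pi) (ζ : ℝ) {y : ℝ → ℂ → ℂ}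
    (hy : ∀ lam, IsSolution q lam (fun x => y x lam)) :
    ∀ᶠ lam in sectorAtInfinity ζ, ∀ x ∈ Icc r x₀, ‖y x lam‖ ≤
      2 * (‖y r lam‖ + ‖slDeriv (fun t => y t lam) r‖ / ‖Complex.sqrt lam‖) *
        Real.exp (|(Complex.sqrt lam).im| * (x - r)) := by
  have ht := tendsto_norm_sqrt ζ
  filter_upwards [ht.eventually_gt_atTop 0,
    ht.eventually_ge_atTop (2 * ∫ t in Icc 0 Real.pi, ‖q t‖)] with lam h1 h2 x hx
  exact IsSolution.norm_le hq (by rw [complexSqrt_sq]; exact hy lam) (norm_pos_iff.1 h1) h2 hr hx.1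
    (hx.2.trans hx₀)

/-- The common form of the four estimates. The hypotheses `hyB` and `hzB` with exponent `0` or `1`
hold for the first and the second fundamental solution respectively; at `lam = 0` they are
statements about division by zero and carry no information, which is harmless since only large
`‖lam‖` matters. -/
theorem wronskian_isLittleO {q qt : ℝ → ℂ}
    (hq : IntegrableOn q (Icc 0 Real.pi)) (hqt : IntegrableOn qt (Icc 0 Real.pi))
    {r x₀ ζ : ℝ} {m : ℕ} (hr : 0 ≤ r) (hrx : r < x₀) (hx₀ : x₀ ≤ Real.pi) (hζ : 0 < ζ)
    (ho : (fun x => qt x - q x) =o[𝓝[≤] x₀] fun x => (x - x₀) ^ m)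
    {y z : ℝ → ℂ → ℂ} {a b : ℕ}
    (hy : ∀ lam, IsSolution q lam (fun x => y x lam))
    (hz : ∀ lam, IsSolution qt lam (fun x => z x lam))
    (hW : ∀ lam, ‖wronskian y z r lam‖ ≤ 1)
    (hyB : ∀ lam, ‖y r lam‖ + ‖slDeriv (fun t => y t lam) r‖ / ‖Complex.sqrt lam‖ =
      1 / ‖Complex.sqrt lam‖ ^ a)
    (hzB : ∀ lam, ‖z r lam‖ + ‖slDeriv (fun t => z t lam) r‖ / ‖Complex.sqrt lam‖ =
      1 / ‖Complex.sqrt lam‖ ^ b) :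
    wronskian y z x₀ =o[sectorAtInfinity ζ] rate r x₀ (m + 1 + a + b) := by
  obtain ⟨c, hc, hsec⟩ := exists_mul_norm_sqrt_le_abs_im hζ
  set g : ℝ → ℝ := fun x => ‖qt x - q x‖
  have hsub : uIcc r x₀ ⊆ Icc 0 Real.pi := by
    rw [uIcc_of_le hrx.le]; exact Icc_subset_Icc hr hx₀
  have hg : IntervalIntegrable g volume r x₀ :=
    (((hqt.mono_set hsub).intervalIntegrable).sub (hq.mono_set hsub).intervalIntegrable).norm
  set I : ℝ → ℝ := fun τ => ∫ x in r..x₀, g x * Real.exp (-(2 * τ * (x₀ - x)))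
  set N := m + 1 + a + b
  -- At `τ = |Im √lam|` this function dominates the quotient of the Wronskian and the rate; the
  -- powers of `1 / c` come from `‖√lam‖ ≤ τ / c`.
  have hΨ : Tendsto (fun τ : ℝ => (1 / c) ^ N * (τ ^ N * Real.exp (-(2 * τ * (x₀ - r)))) +
      4 * (1 / c) ^ (m + 1) * (τ ^ (m + 1) * I τ)) atTop (𝓝 0) := by
    simpa using ((tendsto_pow_mul_exp_neg_mul N (sub_pos.2 hrx)).const_mul ((1 / c) ^ N)).add
      ((tendsto_pow_mul_integral_mul_exp hrx.le hg (fun _ => norm_nonneg _) ho.norm_left).const_mul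
        (4 * (1 / c) ^ (m + 1)))
  rw [isLittleO_iff]
  intro ε hε
  filter_upwards [mem_inf_of_right (s := sector ζ) (mem_principal_self _),
    (tendsto_norm_sqrt ζ).eventually_gt_atTop 0,
    (hΨ.comp (tendsto_abs_im_sqrt hζ)).eventually_lt_const hε,
    eventually_norm_solution_le hq hr hx₀ ζ hy, eventually_norm_solution_le hqt hr hx₀ ζ hz]
    with lam hlam hk0 hlt hyb hzb
  simp only [hyB, hzB] at hyb hzb
  simp only [Function.comp_apply] at hlt
  have hkτ := hsec lam hlam
  set K := ‖Complex.sqrt lam‖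
  set τ := |(Complex.sqrt lam).im|
  have hKτ : K ≤ 1 / c * τ := by
    rw [one_div_mul_eq_div, le_div_iff₀ hc]; linarith
  set E := Real.exp (2 * τ * (x₀ - r))
  have hE : 0 < E := Real.exp_pos _
  have hwr := (hy lam).wronskian_sub hq hqt (hz lam) hr hrx.le hx₀
  have hint : ‖∫ x in r..x₀, (qt x - q x) * (y x lam * z x lam)‖ ≤ 4 / K ^ (a + b) * E * I τ := by
    have hcont : Continuous fun x => Real.exp (-(2 * τ * (x₀ - x))) := by fun_prop
    rw [← intervalIntegral.integral_const_mul]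
    refine intervalIntegral.norm_integral_le_of_norm_le hrx.le (Eventually.of_forall fun x hx => ?_)
      ((hg.mul_continuousOn hcont.continuousOn).const_mul _)
    have hx' : x ∈ Icc r x₀ := Ioc_subset_Icc_self hx
    rw [norm_mul, norm_mul]
    calc ‖qt x - q x‖ * (‖y x lam‖ * ‖z x lam‖)
        ≤ g x * ((2 * (1 / K ^ a) * Real.exp (τ * (x - r))) *
            (2 * (1 / K ^ b) * Real.exp (τ * (x - r)))) := by
          gcongr
          · exact hyb x hx'
          · exact hzb x hx'
      _ = 4 / K ^ (a + b) * g x * (Real.exp (τ * (x - r)) * Real.exp (τ * (x - r))) := by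
          rw [pow_add]; field_simp; ring
      _ = 4 / K ^ (a + b) * g x * (E * Real.exp (-(2 * τ * (x₀ - x)))) := by
          simp only [E]
          rw [← Real.exp_add, ← Real.exp_add]; ring_nf
      _ = _ := by ring
  have hI0 : 0 ≤ I τ :=
    intervalIntegral.integral_nonneg hrx.le fun x _ =>
      mul_nonneg (norm_nonneg _) (Real.exp_pos _).le
  have hWx : ‖wronskian y z x₀ lam‖ ≤ 1 + 4 / K ^ (a + b) * E * I τ := by
    have : wronskian y z x₀ lam = wronskian y z r lam +
        ∫ x in r..x₀, (qt x - q x) * (y x lam * z x lam) := by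
      rw [← hwr, wronskian, wronskian]; ring
    rw [this]
    exact (norm_add_le _ _).trans (add_le_add (hW lam) hint)
  have hrate : ‖rate r x₀ N lam‖ = E / K ^ N := by
    rw [Real.norm_of_nonneg (by unfold rate; positivity), rate]
  rw [hrate]
  refine hWx.trans ?_
  have hEE : Real.exp (-(2 * τ * (x₀ - r))) * E = 1 := by
    rw [← Real.exp_add]; simp
  calc 1 + 4 / K ^ (a + b) * E * I τ
      = (K ^ N * Real.exp (-(2 * τ * (x₀ - r))) + 4 * K ^ (m + 1) * I τ) * (E / K ^ N) := by
        have h1 : K ^ N = K ^ (m + 1) * K ^ (a + b) := by rw [← pow_add]; congr 1; omega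
        rw [h1]
        field_simp
        linear_combination (-K ^ (a + b)) * hEE
    _ ≤ ((1 / c * τ) ^ N * Real.exp (-(2 * τ * (x₀ - r))) + 4 * (1 / c * τ) ^ (m + 1) * I τ) *
          (E / K ^ N) := by gcongr
    _ ≤ ε * (E / K ^ N) := by
        gcongr
        rw [mul_pow, mul_pow]
        linarith

end SturmLiouville

theorem mainTheorem11
    (q qt : ℝ → ℂ)
    (hq : IntegrableOn q (Icc 0 Real.pi)) (hqt : IntegrableOn qt (Icc 0 Real.pi))
    (r x₀ δ ζ : ℝ) (m : ℕ)
    (hr : 0 ≤ r) (hrx : r < x₀) (hx₀ : x₀ ≤ Real.pi) (hδ : 0 < δ) (hζ : 0 < ζ)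
    (hqm : ContDiffOn ℝ m q (Icc (x₀ - δ) x₀)) (hqtm : ContDiffOn ℝ m qt (Icc (x₀ - δ) x₀))
    (hderiv : ∀ j : ℕ, j ≤ m →
      iteratedDerivWithin j q (Icc (x₀ - δ) x₀) x₀ = iteratedDerivWithin j qt (Icc (x₀ - δ) x₀) x₀)
    (y₁ y₂ z₁ z₂ : ℝ → ℂ → ℂ)
    (hy₁ : SturmLiouville.IsFirstFundamental q r y₁)
    (hy₂ : SturmLiouville.IsSecondFundamental q r y₂)
    (hz₁ : SturmLiouville.IsFirstFundamental qt r z₁)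
    (hz₂ : SturmLiouville.IsSecondFundamental qt r z₂) :
    SturmLiouville.wronskian y₁ z₁ x₀
        =o[SturmLiouville.sectorAtInfinity ζ] SturmLiouville.rate r x₀ (m + 1) ∧
    SturmLiouville.wronskian y₁ z₂ x₀
        =o[SturmLiouville.sectorAtInfinity ζ] SturmLiouville.rate r x₀ (m + 2) ∧
    SturmLiouville.wronskian y₂ z₁ x₀
        =o[SturmLiouville.sectorAtInfinity ζ] SturmLiouville.rate r x₀ (m + 2) ∧
    SturmLiouville.wronskian y₂ z₂ x₀
        =o[SturmLiouville.sectorAtInfinity ζ] SturmLiouville.rate r x₀ (m + 3) := by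
  have ho := SturmLiouville.sub_isLittleO_pow_of_iteratedDerivWithin_eq hδ hqtm hqm
    fun j hj => (hderiv j hj).symm
  refine ⟨SturmLiouville.wronskian_isLittleO hq hqt hr hrx hx₀ hζ ho (a := 0) (b := 0)
      (fun lam => (hy₁ lam).1) (fun lam => (hz₁ lam).1) (fun lam => ?_) (fun lam => ?_)
      (fun lam => ?_),
    SturmLiouville.wronskian_isLittleO hq hqt hr hrx hx₀ hζ ho (a := 0) (b := 1)
      (fun lam => (hy₁ lam).1) (fun lam => (hz₂ lam).1) (fun lam => ?_) (fun lam => ?_)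
      (fun lam => ?_),
    SturmLiouville.wronskian_isLittleO hq hqt hr hrx hx₀ hζ ho (a := 1) (b := 0)
      (fun lam => (hy₂ lam).1) (fun lam => (hz₁ lam).1) (fun lam => ?_) (fun lam => ?_)
      (fun lam => ?_),
    SturmLiouville.wronskian_isLittleO hq hqt hr hrx hx₀ hζ ho (a := 1) (b := 1)
      (fun lam => (hy₂ lam).1) (fun lam => (hz₂ lam).1) (fun lam => ?_) (fun lam => ?_)
      (fun lam => ?_)⟩ <;>
  simp [SturmLiouville.wronskian, (hy₁ lam).2.1, (hy₁ lam).2.2, (hy₂ lam).2.1, (hy₂ lam).2.2,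
    (hz₁ lam).2.1, (hz₁ lam).2.2, (hz₂ lam).2.1, (hz₂ lam).2.2]
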